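/- A partition of $n$ is a multiset of positive integers (its parts) with sum $n$; write its parts as $\lambda_1\ge\lambda_2\ge\cdots$, with $\lambda_k=0$ when $k$ exceeds the number of parts, and write $(a^b)$ for the partition consisting of $b$ parts equal to $a$. Let $\mathcal Q_o(n)$ be the set of partitions of $n$ into distinct odd parts, $\mathcal Q_o=\bigcup_{m\ge 0}\mathcal Q_o(m)$ (it contains the empty partition), and let $\mathcal P_e(n,2)$ (respectively $\mathcal P_o(n,2)$) be the set of partitions of $n$ in which the number of even parts, counted with multiplicity, is even (respectively odd). Theorem. Let $n,r\ge 1$ be integers, and let $L_r\subseteq\{2,4,6,\dots,2r\}$ and $O_r\subseteq\{1,3,5,\dots,2r-1\}$. Let $E$ be the number of parts congruent modulo $2r$ to an element of $O_r$ in all partitions in $\mathcal Q_o(n)$, plus the number of parts congruent modulo $2r$ to an element of $L_r$ in all partitions in $\mathcal P_o(n,2)$, minus the number of parts congruent modulo $2r$ to an element of $L_r$ in all partitions in $\mathcal P_e(n,2)$, parts being counted with multiplicity. Let $N$ be the number of pairs of partitions $(\lambda,(a^b))$ with $a,b\ge 1$ and $|\lambda|+ab=n$ ($\lambda$ may be empty)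 such that (i) $a\equiv \ell \pmod{2r}$ for some $\ell\in L_r\cup O_r$, and $b$ is odd; moreover, if $a$ is odd, then $b=1$; (ii) $\lambda\in\mathcal Q_o$; moreover, if $a$ is odd, then $a$ is not a part of $\lambda$; if $a$ is even, then $\lambda_1-\lambda_2\le a$ and $\lambda\notin\{(\tfrac a2+1,\tfrac a2-1),(\tfrac a2+2,\tfrac a2-2)\}$. Then: (1) If $n\not\equiv 0\pmod 4$ or $2\notin L_r$, then $E=N$. (2) If $n\equiv 0\pmod 4$ and $2\in L_r$, then $E=N-1$. If moreover $n\notin\{4,8,12,16,20\}$, then $E$ is equal to the number of pairs $(\lambda,(a^b))$ counted by $N$ that are not of the form $((9,7,5,1),(2^b))$. -/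

import Mathlib

namespace BeckLehmer

/-- The `i`-th largest part of a partition (`i = 1` gives the largest one), counted with
multiplicity, and `0` when `i` exceeds the number of parts. -/
def part {n : ℕ} (lam : n.Partition) (i : ℕ) : ℕ :=
  (lam.parts.sort (· ≥ ·)).getD (i - 1) 0

/-- The partitions of `n` with an even number of even parts (with multiplicity). -/
def evenEven (n : ℕ) : Finset n.Partition :=
  Finset.univ.filter fun lam => Even (lam.parts.countP (fun x => Even x))

/-- The partitions of `n` with an odd number of even parts (with multiplicity). -/
def oddEven (n : ℕ) : Finset n.Partition :=
  Finset.univ.filter fun lam => Odd (lam.parts.countP (fun x => Even x))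

/-- `x` is congruent to some element of `S` modulo `2r`. -/
abbrev InClasses (r : ℕ) (S : Finset ℕ) (x : ℕ) : Prop :=
  ∃ l ∈ S, x ≡ l [MOD 2 * r]

/-- The total number of parts (with multiplicity) in the residue classes `S` modulo `2r`, in all
partitions belonging to `A`. -/
def numParts {n : ℕ} (r : ℕ) (S : Finset ℕ) (A : Finset n.Partition) : ℕ :=
  ∑ lam ∈ A, lam.parts.countP (InClasses r S)

/-- The number of parts in the classes `O` in all partitions of `n` into distinct odd parts, plus
the number of parts in the classes `L` in all partitions of `n` with an odd number of even parts,
minus the number of parts in the classes `L` in all partitions of `n` with an even number of even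
parts. -/
def excess (n r : ℕ) (L O : Finset ℕ) : ℤ :=
  (numParts r O (Nat.Partition.oddDistincts n) : ℤ) + (numParts r L (oddEven n) : ℤ)
    - (numParts r L (evenEven n) : ℤ)

/-- Pairs of partitions; the indices are the sizes of the two partitions. -/
abbrev PartitionPair : Type :=
  Σ s : ℕ × ℕ, s.1.Partition × s.2.Partition

namespace PartitionPair

/-- The first partition of the pair. -/
abbrev first (q : PartitionPair) : q.1.1.Partition := q.2.1

/-- The second partition of the pair. -/
abbrev second (q : PartitionPair) : q.1.2.Partition := q.2.2

end PartitionPair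

/-- The pairs of partitions of total size `n`. -/
def pairs (n : ℕ) : Finset PartitionPair :=
  (Finset.HasAntidiagonal.antidiagonal n).sigma fun _ => Finset.univ

/-- Condition i. on `(a ^ b)`. -/
def CondI (r : ℕ) (L O : Finset ℕ) (a b : ℕ) : Prop :=
  InClasses r (L ∪ O) a ∧ Odd b ∧ (Odd a → b = 1)

/-- Condition ii. on `lam` relative to `a`. A multiset containing `0` is never the multiset of
parts of a partition, so truncation of `a / 2 - 2` at `a = 2` excludes nothing. -/
def CondII {m : ℕ} (lam : m.Partition) (a : ℕ) : Prop :=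
  lam ∈ Nat.Partition.oddDistincts m ∧
  (Odd a → a ∉ lam.parts) ∧
  (Even a → part lam 1 - part lam 2 ≤ a ∧
    lam.parts ≠ {a / 2 + 1, a / 2 - 1} ∧ lam.parts ≠ {a / 2 + 2, a / 2 - 2})

/-- The pair has the form `(lam, (a ^ b))` with `a, b > 0` and satisfies conditions i. and ii. -/
def Admissible (r : ℕ) (L O : Finset ℕ) (q : PartitionPair) : Prop :=
  ∃ a b : ℕ, 0 < a ∧ 0 < b ∧ q.second.parts = Multiset.replicate b a ∧
    CondI r L O a b ∧ CondII q.first a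

/-- The pair has the form `((9, 7, 5, 1), (2 ^ b))`. -/
def IsExceptional (q : PartitionPair) : Prop :=
  q.first.parts = {9, 7, 5, 1} ∧ ∃ b : ℕ, q.second.parts = Multiset.replicate b 2

open Classical in
/-- The admissible pairs of total size `n`. -/
noncomputable def admissiblePairs (n r : ℕ) (L O : Finset ℕ) : Finset PartitionPair :=
  (pairs n).filter fun q => Admissible r L O q

open Classical in
/-- The admissible pairs of total size `n` not of the form `((9, 7, 5, 1), (2 ^ b))`. -/
noncomputable def nonExceptionalPairs (n r : ℕ) (L O : Finset ℕ) : Finset PartitionPair :=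
  (admissiblePairs n r L O).filter fun q => ¬ IsExceptional q

end BeckLehmer

/-! Fix a part size `a` and compare its contributions to both sides. For odd `a`, deleting `a` from
a partition into distinct odd parts matches occurrences of `a` with admissible pairs having `b = 1`
(`oddDistinctsCount_eq`). For even `a`, write Q(m) for the number of partitions of m into distinct
odd parts and S(n) for `signedCount a n`. Lehmer's theorem `sum_sgn` says that Q(m) is the signed
number of all partitions of m. Deleting one part `a` flips the sign, so S(m + a) = Q(m) - S(m), and
twice over S(m + 2a) = Q(m + a) - Q(m) + S(m). Raising the largest part by `a` shows that Q(m + a) -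
Q(m) counts the partitions in Q(m + a) with gap at most `a`, less 1 if m = 0 (`gapCount_add`).
Unrolling gives a sum over odd `b` (`signedCount_eq`). The 1 lost at m = 0 is the excluded two-part
partition of `a`: for `a > 2` exactly one of the two candidates has odd parts. For `a = 2` neither
is a partition, so N gains 1 when n - 2b = 2 for some odd `b`, that is, when 4 divides n. Discarding
a single admissible pair, as in `card_exceptional`, absorbs this surplus. -/

namespace BeckLehmer

/-! ### Lehmer's theorem by a sign-reversing involution -/

/-- The sign `(-1) ^ (number of even parts)`. -/
def sgn (s : Multiset ℕ) : ℤ := (-1) ^ s.countP (fun x => Even x)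

theorem sgn_cons_even {a : ℕ} (h : Even a) (s : Multiset ℕ) : sgn (a ::ₘ s) = -sgn s := by
  simp [sgn, h, pow_succ]

theorem sgn_cons_odd {a : ℕ} (h : Odd a) (s : Multiset ℕ) : sgn (a ::ₘ s) = sgn s := by
  simp [sgn, Nat.not_even_iff_odd.2 h]

theorem sgn_cons_cons (a : ℕ) (s : Multiset ℕ) : sgn (a ::ₘ a ::ₘ s) = sgn s := by
  rcases Nat.even_or_odd a with h | h
  · simp [sgn_cons_even h]
  · simp [sgn_cons_odd h]

/-- The largest even element (`0` if there is none). -/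
def maxEven (s : Multiset ℕ) : ℕ := (s.toFinset.filter fun x => Even x).sup id

/-- The largest repeated element (`0` if there is none). -/
def maxRep (s : Multiset ℕ) : ℕ := (s.toFinset.filter fun x => 2 ≤ s.count x).sup id

theorem le_maxEven {s : Multiset ℕ} {x : ℕ} (hx : x ∈ s) (h : Even x) : x ≤ maxEven s :=
  Finset.le_sup (f := id) (by simp [hx, h])

theorem le_maxRep {s : Multiset ℕ} {x : ℕ} (h : 2 ≤ s.count x) : x ≤ maxRep s :=
  Finset.le_sup (f := id)
    (by simp only [Finset.mem_filter, Multiset.mem_toFinset]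
        exact ⟨Multiset.count_pos.1 (by omega), h⟩)

theorem maxEven_mem {s : Multiset ℕ} (h : 0 < maxEven s) : maxEven s ∈ s ∧ Even (maxEven s) := by
  have hne : (s.toFinset.filter fun x => Even x).Nonempty := by
    rw [Finset.nonempty_iff_ne_empty]
    intro h0
    simp [maxEven, h0] at h
  obtain ⟨x, hx, he⟩ := Finset.exists_mem_eq_sup _ hne id
  rw [show maxEven s = x from he]
  simpa using hx

theorem maxRep_count {s : Multiset ℕ} (h : 0 < maxRep s) : 2 ≤ s.count (maxRep s) := by
  have hne : (s.toFinset.filter fun x => 2 ≤ s.count x).Nonempty := by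
    rw [Finset.nonempty_iff_ne_empty]
    intro h0
    simp [maxRep, h0] at h
  obtain ⟨x, hx, he⟩ := Finset.exists_mem_eq_sup _ hne id
  rw [show maxRep s = x from he]
  exact (Finset.mem_filter.1 hx).2

theorem maxEven_le {s : Multiset ℕ} {b : ℕ} (h : ∀ x ∈ s, Even x → x ≤ b) : maxEven s ≤ b :=
  Finset.sup_le fun x hx => by
    simp only [Finset.mem_filter, Multiset.mem_toFinset] at hx
    exact h x hx.1 hx.2

theorem maxRep_le {s : Multiset ℕ} {b : ℕ} (h : ∀ x, 2 ≤ s.count x → x ≤ b) : maxRep s ≤ b :=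
  Finset.sup_le fun x hx => h x (Finset.mem_filter.1 hx).2

/-- Replace the largest even part `2h` by `h, h`, or the two copies `p, p` of the largest repeated
part by `2p`. -/
def splitMerge (s : Multiset ℕ) : Multiset ℕ :=
  if 2 * maxRep s ≤ maxEven s then
    (maxEven s / 2) ::ₘ (maxEven s / 2) ::ₘ s.erase (maxEven s)
  else (2 * maxRep s) ::ₘ (s.erase (maxRep s)).erase (maxRep s)

/-- After splitting `2a`, the pair `a, a` is the largest repetition and all even parts are below
`2a`, so the next move merges it. After merging `a, a`, the largest even part is `2a` and repeated
parts are at most `a`, so the next move splits it. The tie belongs to splitting. -/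
theorem splitMerge_cases {s : Multiset ℕ} (h : 0 < maxEven s ∨ 0 < maxRep s) :
    (∃ a u, 0 < a ∧ s = (2 * a) ::ₘ u ∧ splitMerge s = a ::ₘ a ::ₘ u ∧
      splitMerge (a ::ₘ a ::ₘ u) = s) ∨
    (∃ a u, 0 < a ∧ s = a ::ₘ a ::ₘ u ∧ splitMerge s = (2 * a) ::ₘ u ∧
      splitMerge ((2 * a) ::ₘ u) = s) := by
  by_cases hc : 2 * maxRep s ≤ maxEven s
  · left
    have hpos : 0 < maxEven s := by omega
    obtain ⟨hm, ⟨a, ha⟩⟩ := maxEven_mem hpos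
    obtain ⟨u, hu⟩ := Multiset.exists_cons_of_mem hm
    have ha2 : maxEven s = 2 * a := by omega
    rw [ha2] at hu
    -- A second copy of `2a` would be a repetition too large for the split case; its absence makes
    -- the remaining even parts strictly smaller than `2a`.
    have hau : 2 * a ∉ u := by
      intro hmem
      have : 2 ≤ s.count (2 * a) := by
        rw [hu, Multiset.count_cons_self]
        have := Multiset.count_pos.2 hmem
        omega
      have := le_maxRep this
      omega
    have hR : maxRep (a ::ₘ a ::ₘ u) = a := by
      apply le_antisymm
      · apply maxRep_le
        intro x hx
        by_cases hxa : x = a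
        · exact hxa.le
        · rw [Multiset.count_cons_of_ne hxa, Multiset.count_cons_of_ne hxa] at hx
          have : x ≤ maxRep s := le_maxRep
            (hx.trans (by rw [hu]; exact Multiset.count_le_count_cons _ _ _))
          omega
      · exact le_maxRep (by simp)
    have hE : maxEven (a ::ₘ a ::ₘ u) < 2 * a := by
      have : maxEven (a ::ₘ a ::ₘ u) ≤ 2 * a - 1 := by
        apply maxEven_le
        intro x hx he
        simp only [Multiset.mem_cons] at hx
        rcases hx with rfl | rfl | hx
        · omega
        · omega
        · have h1 : x ≤ maxEven s := le_maxEven (by rw [hu]; simp [hx]) he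
          have h2 : x ≠ 2 * a := fun h => hau (h ▸ hx)
          omega
      omega
    refine ⟨a, u, by omega, hu, ?_, ?_⟩
    · rw [splitMerge, if_pos hc, ha2]
      have : 2 * a / 2 = a := by omega
      rw [this]
      congr 2
      rw [hu, Multiset.erase_cons_head]
    · rw [splitMerge, if_neg (by rw [hR]; omega), hR, Multiset.erase_cons_head,
        Multiset.erase_cons_head, hu]
  · right
    have hpos : 0 < maxRep s := by omega
    have hcount := maxRep_count hpos
    obtain ⟨a, ha⟩ : ∃ a, a = maxRep s := ⟨_, rfl⟩
    rw [← ha] at hc hpos hcount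
    obtain ⟨v, hv⟩ := Multiset.exists_cons_of_mem (Multiset.count_pos.1 (by omega : 0 < s.count a))
    have : 0 < v.count a := by
      rw [hv, Multiset.count_cons_self] at hcount
      omega
    obtain ⟨u, rfl⟩ := Multiset.exists_cons_of_mem (Multiset.count_pos.1 this)
    have hE : maxEven ((2 * a) ::ₘ u) = 2 * a := by
      apply le_antisymm
      · apply maxEven_le
        intro x hx he
        rcases Multiset.mem_cons.1 hx with rfl | hx
        · exact le_rfl
        · have : x ≤ maxEven s := le_maxEven (by rw [hv]; simp [hx]) he
          omega
      · exact le_maxEven (by simp) (by simp)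
    have hR : maxRep ((2 * a) ::ₘ u) ≤ a := by
      apply maxRep_le
      intro x hx
      by_cases hxa : x = 2 * a
      · subst hxa
        rw [Multiset.count_cons_self] at hx
        have hmem : 2 * a ∈ u := Multiset.count_pos.1 (by omega)
        have : 2 * a ≤ maxEven s := le_maxEven (by rw [hv]; simp [hmem]) (by simp)
        omega
      · rw [Multiset.count_cons_of_ne hxa] at hx
        rw [ha]
        refine le_maxRep (hx.trans ?_)
        rw [hv]
        exact (Multiset.count_le_count_cons _ _ _).trans (Multiset.count_le_count_cons _ _ _)
    refine ⟨a, u, hpos, hv, ?_, ?_⟩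
    · rw [splitMerge, if_neg (by rw [← ha]; exact hc), ← ha, hv, Multiset.erase_cons_head,
        Multiset.erase_cons_head]
    · rw [splitMerge, hE, if_pos (by omega), Multiset.erase_cons_head, hv]
      have : 2 * a / 2 = a := by omega
      rw [this]

theorem mem_oddDistincts {n : ℕ} {lam : n.Partition} :
    lam ∈ Nat.Partition.oddDistincts n ↔ (∀ x ∈ lam.parts, Odd x) ∧ lam.parts.Nodup := by
  simp [Nat.Partition.oddDistincts, Nat.Partition.odds, Nat.Partition.restricted,
    Nat.Partition.distincts]

theorem maxEven_or_maxRep_pos_iff {n : ℕ} {lam : n.Partition} :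
    (0 < maxEven lam.parts ∨ 0 < maxRep lam.parts) ↔ lam ∉ Nat.Partition.oddDistincts n := by
  rw [mem_oddDistincts, not_and_or]
  refine or_congr ⟨fun h hodd => ?_, fun h => ?_⟩ ⟨fun h hnd => ?_, fun h => ?_⟩
  · obtain ⟨h1, h2⟩ := maxEven_mem h
    exact Nat.not_even_iff_odd.2 (hodd _ h1) h2
  · push Not at h
    obtain ⟨x, hx, hx2⟩ := h
    exact (lam.parts_pos hx).trans_le (le_maxEven hx (by simpa using hx2))
  · have := maxRep_count h
    have := Multiset.nodup_iff_count_le_one.1 hnd (maxRep lam.parts)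
    omega
  · rw [Multiset.nodup_iff_count_le_one] at h
    push Not at h
    obtain ⟨x, hx⟩ := h
    exact (lam.parts_pos (Multiset.count_pos.1 (by omega : 0 < lam.parts.count x))).trans_le
      (le_maxRep hx)

theorem splitMerge_spec {s : Multiset ℕ} (hs : ∀ x ∈ s, 0 < x)
    (h : 0 < maxEven s ∨ 0 < maxRep s) :
    (∀ x ∈ splitMerge s, 0 < x) ∧ (splitMerge s).sum = s.sum ∧
      (0 < maxEven (splitMerge s) ∨ 0 < maxRep (splitMerge s)) ∧
      splitMerge (splitMerge s) = s ∧ sgn s + sgn (splitMerge s) = 0 := by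
  rcases splitMerge_cases h with ⟨a, u, ha, h1, h2, h3⟩ | ⟨a, u, ha, h1, h2, h3⟩
  · rw [h2, h3]
    refine ⟨?_, ?_, Or.inr (ha.trans_le (le_maxRep (by simp))), rfl, ?_⟩
    · intro x hx
      simp only [Multiset.mem_cons, or_self_left] at hx
      rcases hx with rfl | hx
      · exact ha
      · exact hs x (by rw [h1]; simp [hx])
    · rw [h1]; simp only [Multiset.sum_cons]; omega
    · rw [h1, sgn_cons_even (by simp), sgn_cons_cons]; ring
  · rw [h2, h3]
    refine ⟨?_, ?_, Or.inl ?_, rfl, ?_⟩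
    · intro x hx
      simp only [Multiset.mem_cons] at hx
      rcases hx with rfl | hx
      · omega
      · exact hs x (by rw [h1]; simp [hx])
    · rw [h1]; simp only [Multiset.sum_cons]; omega
    · exact (by omega : 0 < 2 * a).trans_le (le_maxEven (by simp) (by simp))
    · rw [h1, sgn_cons_cons, sgn_cons_even (by simp : Even (2 * a))]; ring

/-- Lehmer's theorem. -/
theorem sum_sgn (n : ℕ) :
    ∑ lam : n.Partition, sgn lam.parts = ((Nat.Partition.oddDistincts n).card : ℤ) := by
  classical
  rw [← Finset.sum_add_sum_compl (Nat.Partition.oddDistincts n)]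
  have h1 : ∑ lam ∈ Nat.Partition.oddDistincts n, sgn lam.parts =
      ((Nat.Partition.oddDistincts n).card : ℤ) := by
    rw [Finset.card_eq_sum_ones, Nat.cast_sum]
    refine Finset.sum_congr rfl fun lam hlam => ?_
    have : lam.parts.countP (fun x => Even x) = 0 := by
      rw [Multiset.countP_eq_zero]
      exact fun x hx => Nat.not_even_iff_odd.2 ((mem_oddDistincts.1 hlam).1 x hx)
    simp [sgn, this]
  have h2 : ∑ lam ∈ (Nat.Partition.oddDistincts n)ᶜ, sgn lam.parts = 0 := by
    have key (lam : n.Partition) (hl : lam ∈ (Nat.Partition.oddDistincts n)ᶜ) :=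
      splitMerge_spec (fun x hx => lam.parts_pos hx)
        (maxEven_or_maxRep_pos_iff.2 (Finset.mem_compl.1 hl))
    refine Finset.sum_involution
      (fun lam hl => ⟨splitMerge lam.parts, fun {i} hi => (key lam hl).1 i hi,
        (key lam hl).2.1.trans lam.parts_sum⟩) ?_ ?_ ?_ ?_
    · exact fun lam hl => (key lam hl).2.2.2.2
    · intro lam hl hne heq
      have h3 := (key lam hl).2.2.2.2
      rw [show splitMerge lam.parts = lam.parts from congrArg Nat.Partition.parts heq] at h3
      omega
    · intro lam hl
      rw [Finset.mem_compl, ← maxEven_or_maxRep_pos_iff]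
      exact (key lam hl).2.2.1
    · exact fun lam hl => Nat.Partition.ext (key lam hl).2.2.2.1
  rw [h1, h2, add_zero]


/-! ### The recurrence for signed counts of an even part -/

/-- The partition obtained by adding a part `a`. -/
def consPart {m : ℕ} (a : ℕ) (ha : 0 < a) (mu : m.Partition) : (m + a).Partition :=
  ⟨a ::ₘ mu.parts, fun {i} hi => by
    rcases Multiset.mem_cons.1 hi with rfl | hi
    exacts [ha, mu.parts_pos hi], by simp [mu.parts_sum, add_comm]⟩

theorem sum_partition_add {M : Type*} [AddCommMonoid M] (f : Multiset ℕ → M) (m a : ℕ) (ha : 0 < a)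
    (hf : ∀ s, a ∉ s → f s = 0) :
    ∑ lam : (m + a).Partition, f lam.parts = ∑ mu : m.Partition, f (a ::ₘ mu.parts) := by
  symm
  refine Finset.sum_of_injOn (consPart a ha) ?_ (by simp) ?_ (fun _ _ => rfl)
  · intro x _ y _ h
    exact Nat.Partition.ext
      ((Multiset.cons_inj_right a).1 (congrArg Nat.Partition.parts h))
  · intro lam _ h
    refine hf _ fun hmem => h ?_
    obtain ⟨u, hu⟩ := Multiset.exists_cons_of_mem hmem
    refine ⟨⟨u, fun {i} hi => lam.parts_pos (by rw [hu]; simp [hi]), ?_⟩, by simp,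
      Nat.Partition.ext hu.symm⟩
    have := lam.parts_sum
    rw [hu, Multiset.sum_cons] at this
    omega

theorem notMem_parts_of_lt {n a : ℕ} (h : n < a) (lam : n.Partition) : a ∉ lam.parts := by
  intro hm
  have := Multiset.single_le_sum (fun x _ => Nat.zero_le x) a hm
  rw [lam.parts_sum] at this
  omega

/-- The number of parts `a` in all partitions of `n`, each counted with minus the sign of its
partition. -/
def signedCount (a n : ℕ) : ℤ := ∑ lam : n.Partition, -(sgn lam.parts * lam.parts.count a)

theorem signedCount_of_lt {a n : ℕ} (h : n < a) : signedCount a n = 0 :=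
  Finset.sum_eq_zero fun lam _ => by simp [Multiset.count_eq_zero.2 (notMem_parts_of_lt h lam)]

/-- Deleting one `a` flips the sign and lowers the multiplicity by one; the extra one sums to the
count in Lehmer's theorem. -/
theorem signedCount_add {a : ℕ} (ha : 0 < a) (he : Even a) (m : ℕ) :
    signedCount a (m + a) = (Nat.Partition.oddDistincts m).card - signedCount a m := by
  rw [signedCount, sum_partition_add (fun s => -(sgn s * s.count a)) m a ha
    (fun s hs => by simp [Multiset.count_eq_zero.2 hs]), ← sum_sgn, signedCount,
    ← Finset.sum_sub_distrib]
  refine Finset.sum_congr rfl fun mu _ => ?_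
  rw [sgn_cons_even he, Multiset.count_cons_self]
  push_cast
  ring

/-! ### The gap between the two largest parts -/

theorem exists_cons_max {s : Multiset ℕ} (h : s ≠ 0) :
    ∃ M u, s = M ::ₘ u ∧ ∀ x ∈ u, x ≤ M := by
  obtain ⟨M, hM, hmax⟩ := Multiset.exists_max_image id h
  obtain ⟨u, rfl⟩ := Multiset.exists_cons_of_mem hM
  exact ⟨M, u, rfl, fun x hx => hmax x (by simp [hx])⟩

/-- This replaces the sorted list by a multiset condition. The clause `a < M` accounts for a missing
second part, which counts as 0. -/
theorem gap_le_iff {n : ℕ} {lam : n.Partition} {M : ℕ} {u : Multiset ℕ} (h : lam.parts = M ::ₘ u)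
    (hu : ∀ x ∈ u, x ≤ M) (a : ℕ) :
    part lam 1 - part lam 2 ≤ a ↔ ¬ (a < M ∧ ∀ x ∈ u, x + a < M) := by
  have h1 : part lam 1 = M := by
    simp [part, h, Multiset.sort_cons M u (· ≥ ·) hu]
  rcases eq_or_ne u 0 with rfl | hne
  · have h2 : part lam 2 = 0 := by
      simp [part, h]
    rw [h1, h2]
    simp
  · obtain ⟨M', v, rfl, hv⟩ := exists_cons_max hne
    have h2 : part lam 2 = M' := by
      simp [part, h, Multiset.sort_cons M _ (· ≥ ·) hu, Multiset.sort_cons M' v (· ≥ ·) hv]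
    rw [h1, h2]
    simp only [Multiset.mem_cons, forall_eq_or_imp]
    constructor
    · rintro h3 ⟨h4, h5, -⟩
      omega
    · intro h3
      by_contra h4
      refine h3 ⟨by omega, by omega, fun x hx => ?_⟩
      have := hv x hx
      omega

/-- The number of partitions of `m` into distinct odd parts whose two largest parts differ by at
most `a`. -/
def gapCount (a m : ℕ) : ℕ :=
  ((Nat.Partition.oddDistincts m).filter fun lam => part lam 1 - part lam 2 ≤ a).card

theorem gapCount_of_le {a m : ℕ} (h : m ≤ a) :
    gapCount a m = (Nat.Partition.oddDistincts m).card := by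
  rw [gapCount, Finset.filter_true_of_mem]
  intro lam _
  by_cases h0 : lam.parts = 0
  · simp [part, h0]
  · obtain ⟨M, u, hM, hu⟩ := exists_cons_max h0
    rw [gap_le_iff hM hu]
    rintro ⟨h1, -⟩
    exact notMem_parts_of_lt (h.trans_lt h1) lam (by simp [hM])

theorem parts_ne_zero {m : ℕ} (hm : 0 < m) (lam : m.Partition) : lam.parts ≠ 0 := by
  intro h
  have := lam.parts_sum
  rw [h, Multiset.sum_zero] at this
  omega

theorem card_oddDistincts_zero : (Nat.Partition.oddDistincts 0).card = 1 := by
  decide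

/-- Add `a` to the largest element. -/
def raiseMax (a : ℕ) (s : Multiset ℕ) : Multiset ℕ :=
  (s.toFinset.sup id + a) ::ₘ s.erase (s.toFinset.sup id)

theorem raiseMax_cons {M : ℕ} {u : Multiset ℕ} (hu : ∀ x ∈ u, x ≤ M) (a : ℕ) :
    raiseMax a (M ::ₘ u) = (M + a) ::ₘ u := by
  have : (M ::ₘ u).toFinset.sup id = M := by
    apply le_antisymm
    · refine Finset.sup_le fun x hx => ?_
      simp only [Multiset.mem_toFinset, Multiset.mem_cons] at hx
      rcases hx with rfl | hx
      exacts [le_rfl, hu x hx]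
    · exact Finset.le_sup (f := id) (by simp)
  rw [raiseMax, this, Multiset.erase_cons_head]

/-- Adding `a` to the largest part is a bijection: evenness of `a` preserves odd parts, and `0 < m`
guarantees a part to raise. -/
theorem card_gap_gt {a m : ℕ} (hm : 0 < m) (he : Even a) :
    ((Nat.Partition.oddDistincts (m + a)).filter
      fun lam => ¬ (part lam 1 - part lam 2 ≤ a)).card = (Nat.Partition.oddDistincts m).card := by
  symm
  have key (lam : m.Partition) : ∃ M u, lam.parts = M ::ₘ u ∧ (∀ x ∈ u, x ≤ M) ∧
      raiseMax a lam.parts = (M + a) ::ₘ u := by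
    obtain ⟨M, u, h, hu⟩ := exists_cons_max (parts_ne_zero hm lam)
    exact ⟨M, u, h, hu, by rw [h, raiseMax_cons hu]⟩
  refine Finset.card_bij (fun lam _ => ⟨raiseMax a lam.parts, ?_, ?_⟩) ?_ ?_ ?_
  · intro i hi
    obtain ⟨M, u, h, hu, hr⟩ := key lam
    rw [hr, Multiset.mem_cons] at hi
    rcases hi with rfl | hi
    · have : 0 < M := lam.parts_pos (by simp [h])
      omega
    · exact lam.parts_pos (by simp [h, hi])
  · obtain ⟨M, u, h, hu, hr⟩ := key lam
    rw [hr]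
    have := lam.parts_sum
    rw [h] at this
    simp only [Multiset.sum_cons] at this ⊢
    omega
  · intro lam hlam
    obtain ⟨M, u, h, hu, hr⟩ := key lam
    rw [mem_oddDistincts, h, Multiset.nodup_cons] at hlam
    obtain ⟨hodd, hM, hnd⟩ := hlam
    have hlt : ∀ x ∈ u, x < M := fun x hx =>
      lt_of_le_of_ne (hu x hx) (fun hxM => hM (hxM ▸ hx))
    have hpos : 0 < M := lam.parts_pos (by simp [h])
    rw [Finset.mem_filter, mem_oddDistincts,
      gap_le_iff (M := M + a) (u := u) hr (fun x hx => by have := hu x hx; omega), not_not]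
    dsimp only
    rw [hr]
    refine ⟨⟨fun x hx => ?_, ?_⟩, by omega, fun x hx => by have := hlt x hx; omega⟩
    · rcases Multiset.mem_cons.1 hx with rfl | hx
      · exact (hodd M (by simp)).add_even he
      · exact hodd x (by simp [hx])
    · rw [Multiset.nodup_cons]
      exact ⟨fun hx => by have := hlt _ hx; omega, hnd⟩
  · intro lam _ mu _ heq
    obtain ⟨M, u, h, hu, hr⟩ := key lam
    obtain ⟨M', u', h', hu', hr'⟩ := key mu
    have heq2 : raiseMax a lam.parts = raiseMax a mu.parts := congrArg Nat.Partition.parts heq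
    rw [hr, hr'] at heq2
    -- If the raised maxima differed, each would lie among the other's smaller parts, giving `M + a
    -- ≤ M'` and `M' + a ≤ M`.
    have hMM : M = M' := by
      have hb := Multiset.mem_cons.1 (heq2 ▸ Multiset.mem_cons_self (M + a) u)
      have hb' := Multiset.mem_cons.1 (heq2 ▸ Multiset.mem_cons_self (M' + a) u')
      rcases hb with hb | hb
      · omega
      · rcases hb' with hb' | hb'
        · omega
        · have := hu' _ hb
          have := hu _ hb'
          omega
    subst hMM
    rw [Multiset.cons_inj_right] at heq2
    exact Nat.Partition.ext (by rw [h, h', heq2])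
  · intro mu hmu
    rw [Finset.mem_filter, mem_oddDistincts] at hmu
    obtain ⟨M, u, h, hu⟩ := exists_cons_max (parts_ne_zero (by omega) mu)
    rw [gap_le_iff h hu, not_not, h, Multiset.nodup_cons] at hmu
    obtain ⟨⟨hodd, hM, hnd⟩, haM, hx⟩ := hmu
    obtain ⟨K, rfl⟩ := Nat.exists_eq_add_of_le haM.le
    have hK : Odd K := by
      have := hodd (a + K) (by simp)
      rw [Nat.odd_add] at this
      by_contra hc
      rw [Nat.not_odd_iff_even] at hc
      exact Nat.not_even_iff_odd.2 (this.2 hc) he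
    refine ⟨⟨K ::ₘ u, fun {i} hi => ?_, ?_⟩, ?_, Nat.Partition.ext ?_⟩
    · rcases Multiset.mem_cons.1 hi with rfl | hi
      · omega
      · exact mu.parts_pos (by simp [h, hi])
    · have := mu.parts_sum
      rw [h] at this
      simp only [Multiset.sum_cons] at this ⊢
      omega
    · rw [mem_oddDistincts]
      refine ⟨fun x hxm => ?_, ?_⟩
      · rcases Multiset.mem_cons.1 hxm with rfl | hxm
        · exact hK
        · exact hodd x (by simp [hxm])
      · rw [Multiset.nodup_cons]
        exact ⟨fun hKu => by have := hx K hKu; omega, hnd⟩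
    · dsimp only
      rw [raiseMax_cons (fun x hxm => by have := hx x hxm; omega), h, add_comm]

/-- The correction at `m = 0` comes from the empty partition, which has no largest part to raise. -/
theorem gapCount_add {a : ℕ} (he : Even a) (m : ℕ) :
    gapCount a (m + a) + (Nat.Partition.oddDistincts m).card =
      (Nat.Partition.oddDistincts (m + a)).card + if m = 0 then 1 else 0 := by
  rcases Nat.eq_zero_or_pos m with rfl | hm
  · rw [gapCount_of_le (by omega), card_oddDistincts_zero, if_pos rfl]
  · rw [← card_gap_gt hm he, gapCount, Finset.card_filter_add_card_filter_not, if_neg hm.ne',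
      add_zero]

theorem signedCount_add_two_mul {a : ℕ} (ha : 0 < a) (he : Even a) (m : ℕ) :
    signedCount a (m + 2 * a) =
      (gapCount a (m + a) : ℤ) - (if m + a = a then 1 else 0) + signedCount a m := by
  have h1 := signedCount_add ha he m
  have h2 := signedCount_add ha he (m + a)
  have h3 := congrArg (Nat.cast : ℕ → ℤ) (gapCount_add he m)
  push_cast at h3
  rw [show m + 2 * a = m + a + a by ring, h2, h1]
  have : ((if m + a = a then 1 else 0 : ℤ)) = if m = 0 then 1 else 0 := by
    simp
  rw [this]
  linarith

/-- The sum of `f (n - a * b)` over the odd `b` with `a * b ≤ n`. -/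
def oddMultipleSum (f : ℕ → ℤ) (a n : ℕ) : ℤ :=
  ∑ b ∈ (Finset.range (n + 1)).filter fun b => Odd b ∧ a * b ≤ n, f (n - a * b)

/-- Induction in steps of `2a`: the term `b = 1` is new and the others are those of `n - 2a` with
`b` shifted by 2. For `a ≤ n < 2a` only `b = 1` survives, with no gap restriction in force. -/
theorem signedCount_eq {a : ℕ} (ha : 0 < a) (he : Even a) (n : ℕ) :
    signedCount a n =
      oddMultipleSum (fun m => (gapCount a m : ℤ) - if m = a then 1 else 0) a n := by
  induction n using Nat.strong_induction_on with
  | _ n ih =>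
    rcases lt_or_ge n a with h | h
    · rw [signedCount_of_lt h, oddMultipleSum, Finset.filter_false_of_mem, Finset.sum_empty]
      rintro b - ⟨⟨k, rfl⟩, hb⟩
      nlinarith
    rcases lt_or_ge n (2 * a) with h2 | h2
    · obtain ⟨m, rfl⟩ := Nat.exists_eq_add_of_le' h
      have : (Finset.range (m + a + 1)).filter (fun b => Odd b ∧ a * b ≤ m + a) = {1} := by
        ext b
        simp only [Finset.mem_filter, Finset.mem_range, Finset.mem_singleton]
        constructor
        · rintro ⟨-, ⟨k, rfl⟩, hb⟩
          have : k = 0 := by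
            by_contra hk
            have : 1 ≤ k := by omega
            nlinarith
          omega
        · rintro rfl
          exact ⟨by omega, odd_one, by omega⟩
      rw [oddMultipleSum, this, Finset.sum_singleton, signedCount_add ha he,
        signedCount_of_lt (by omega), mul_one, Nat.add_sub_cancel, gapCount_of_le (by omega),
        if_neg (by omega)]
    · obtain ⟨m, rfl⟩ := Nat.exists_eq_add_of_le' h2
      rw [signedCount_add_two_mul ha he, ih m (by omega), oddMultipleSum, oddMultipleSum]
      have : (Finset.range (m + 2 * a + 1)).filter (fun b => Odd b ∧ a * b ≤ m + 2 * a) =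
          insert 1 (((Finset.range (m + 1)).filter fun b => Odd b ∧ a * b ≤ m).image
            (· + 2)) := by
        ext b
        simp only [Finset.mem_filter, Finset.mem_range, Finset.mem_insert, Finset.mem_image]
        constructor
        · rintro ⟨-, ho, hb⟩
          rcases eq_or_ne b 1 with rfl | hb1
          · exact Or.inl rfl
          · right
            obtain ⟨k, rfl⟩ := ho
            have hk : a * (2 * k - 1) ≤ m := by
              obtain ⟨j, rfl⟩ : ∃ j, k = j + 1 := ⟨k - 1, by omega⟩
              have : 2 * (j + 1) - 1 = 2 * j + 1 := by omega
              rw [this]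
              nlinarith
            refine ⟨2 * k - 1, ⟨?_, ⟨k - 1, by omega⟩, hk⟩, by omega⟩
            have := Nat.le_mul_of_pos_left (2 * k - 1) ha
            omega
        · rintro (rfl | ⟨c, ⟨h1, ho, hb⟩, rfl⟩)
          · exact ⟨by omega, odd_one, by omega⟩
          · exact ⟨by omega, ho.add_even even_two, by nlinarith⟩
      rw [this, Finset.sum_insert, Finset.sum_image (by intro x _ y _ h; simpa using h)]
      · have h3 : m + 2 * a - a * 1 = m + a := by omega
        have h4 (c : ℕ) : m + 2 * a - a * (c + 2) = m - a * c := by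
          rw [mul_add, mul_comm a 2, Nat.add_sub_add_right]
        simp only [h3, h4]
      · simp only [Finset.mem_image, Finset.mem_filter, not_exists, not_and]
        intro x hx h
        omega


/-! ### Both sides as sums over the part size -/

theorem partition_ext_parts {m m' : ℕ} {lam : m.Partition} {lam' : m'.Partition}
    (h : lam.parts = lam'.parts) : m = m' := by
  rw [← lam.parts_sum, h, lam'.parts_sum]

theorem PartitionPair.ext_parts {q q' : PartitionPair} (h1 : q.first.parts = q'.first.parts)
    (h2 : q.second.parts = q'.second.parts) : q = q' := by
  obtain ⟨⟨s, t⟩, lam, mu⟩ := q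
  obtain ⟨⟨s', t'⟩, lam', mu'⟩ := q'
  obtain rfl := partition_ext_parts h1
  obtain rfl := partition_ext_parts h2
  obtain rfl := Nat.Partition.ext h1
  obtain rfl := Nat.Partition.ext h2
  rfl

/-- The partition `(a ^ b)`. -/
def rectangle (a b : ℕ) (ha : 0 < a) : (a * b).Partition :=
  ⟨Multiset.replicate b a, fun hi => (Multiset.eq_of_mem_replicate hi) ▸ ha, by
    simp [mul_comm]⟩

open Classical in
/-- The number of partitions of `m` satisfying condition ii. relative to `a`. -/
noncomputable def condIICount (a m : ℕ) : ℕ :=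
  (Finset.univ.filter fun lam : m.Partition => CondII lam a).card

theorem replicate_inj {a b a' b' : ℕ} (hb : 0 < b)
    (h : Multiset.replicate b a = Multiset.replicate b' a') : a = a' ∧ b = b' := by
  have hbb : b = b' := by simpa using congrArg Multiset.card h
  refine ⟨Multiset.eq_of_mem_replicate (n := b') ?_, hbb⟩
  rw [← h]
  exact Multiset.mem_replicate.2 ⟨hb.ne', rfl⟩

open Classical in
theorem card_admissiblePairs (n r : ℕ) (L O : Finset ℕ) :
    (admissiblePairs n r L O).card =
      ∑ a ∈ (Finset.Icc 1 n).filter (InClasses r (L ∪ O)),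
        ∑ b ∈ (Finset.range (n + 1)).filter fun b => Odd b ∧ a * b ≤ n ∧ (Odd a → b = 1),
          condIICount a (n - a * b) := by
  symm
  simp only [condIICount]
  simp_rw [← Finset.card_sigma]
  refine Finset.card_bij
    (fun x hx => ⟨(n - x.1 * x.2.1, x.1 * x.2.1), x.2.2, rectangle x.1 x.2.1 ?_⟩) ?_ ?_ ?_
  · simp only [Finset.mem_sigma, Finset.mem_filter, Finset.mem_Icc] at hx
    omega
  · rintro ⟨a, b, lam⟩ hx
    simp only [Finset.mem_sigma, Finset.mem_filter, Finset.mem_Icc, Finset.mem_range,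
      Finset.mem_univ, true_and] at hx
    obtain ⟨⟨⟨ha, -⟩, hc⟩, ⟨-, hb, hab, h1⟩, hII⟩ := hx
    simp only [admissiblePairs, pairs, Finset.mem_filter, Finset.mem_sigma,
      Finset.HasAntidiagonal.mem_antidiagonal, Finset.mem_univ, and_true]
    exact ⟨by omega, a, b, ha, hb.pos, rfl, ⟨hc, hb, h1⟩, hII⟩
  · rintro ⟨a, b, lam⟩ hx ⟨a', b', lam'⟩ hx' heq
    simp only [Finset.mem_sigma, Finset.mem_filter] at hx hx'
    have h2 : Multiset.replicate b a = Multiset.replicate b' a' :=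
      congrArg (fun q : PartitionPair => q.second.parts) heq
    have h1 : lam.parts = lam'.parts := congrArg (fun q : PartitionPair => q.first.parts) heq
    obtain ⟨rfl, rfl⟩ := replicate_inj hx.2.1.2.1.pos h2
    rw [Nat.Partition.ext h1]
  · rintro ⟨⟨s, t⟩, lam, mu⟩ hq
    simp only [admissiblePairs, pairs, Finset.mem_filter, Finset.mem_sigma,
      Finset.HasAntidiagonal.mem_antidiagonal, Finset.mem_univ, and_true] at hq
    obtain ⟨hst, a, b, ha, hb, hmu, ⟨hc, hbo, h1⟩, hII⟩ := hq
    have ht : t = a * b := by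
      have := mu.parts_sum
      rw [show mu.parts = _ from hmu] at this
      simpa [mul_comm] using this.symm
    have hs : s = n - a * b := by omega
    subst hs
    have hle1 := Nat.le_mul_of_pos_right a hb
    have hle2 := Nat.le_mul_of_pos_left b ha
    refine ⟨⟨a, b, lam⟩, ?_, PartitionPair.ext_parts rfl hmu.symm⟩
    simp only [Finset.mem_sigma, Finset.mem_filter, Finset.mem_Icc, Finset.mem_range,
      Finset.mem_univ, true_and]
    exact ⟨⟨⟨ha, by omega⟩, hc⟩, ⟨by omega, hbo, by omega, h1⟩, hII⟩

theorem countP_eq_sum_count {n : ℕ} (p : ℕ → Prop) [DecidablePred p] (lam : n.Partition) :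
    lam.parts.countP p = ∑ a ∈ (Finset.Icc 1 n).filter p, lam.parts.count a := by
  rw [Multiset.countP_eq_card_filter,
    ← Multiset.sum_count_eq_card (s := (Finset.Icc 1 n).filter p)]
  · refine Finset.sum_congr rfl fun a ha => ?_
    rw [Multiset.count_filter_of_pos (Finset.mem_filter.1 ha).2]
  · intro a ha
    rw [Multiset.mem_filter] at ha
    have h1 := lam.parts_pos ha.1
    have h2 : ¬ n < a := fun h => notMem_parts_of_lt h lam ha.1
    simp only [Finset.mem_filter, Finset.mem_Icc]
    exact ⟨⟨h1, by omega⟩, ha.2⟩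

/-- The number of parts `a` in all partitions of `n` into distinct odd parts. -/
def oddDistinctsCount (a n : ℕ) : ℕ := ∑ lam ∈ Nat.Partition.oddDistincts n, lam.parts.count a

theorem numParts_eq_sum {n : ℕ} (r : ℕ) (S : Finset ℕ) (A : Finset n.Partition) :
    numParts r S A = ∑ a ∈ (Finset.Icc 1 n).filter (InClasses r S), ∑ lam ∈ A,
      lam.parts.count a := by
  rw [numParts, Finset.sum_comm]
  exact Finset.sum_congr rfl fun lam _ => countP_eq_sum_count _ lam

theorem sum_oddEven_sub_sum_evenEven {n : ℕ} (f : n.Partition → ℤ) :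
    ∑ lam ∈ oddEven n, f lam - ∑ lam ∈ evenEven n, f lam = ∑ lam, -(sgn lam.parts * f lam) := by
  rw [oddEven, evenEven, Finset.sum_filter, Finset.sum_filter, ← Finset.sum_sub_distrib]
  refine Finset.sum_congr rfl fun lam _ => ?_
  rcases Nat.even_or_odd (lam.parts.countP fun x => Even x) with h | h
  · simp [sgn, h, Nat.not_odd_iff_even.2 h]
  · simp [sgn, h, Nat.not_even_iff_odd.2 h]

theorem excess_eq_sum (n r : ℕ) (L O : Finset ℕ) :
    excess n r L O =
      ∑ a ∈ (Finset.Icc 1 n).filter (InClasses r O), (oddDistinctsCount a n : ℤ) +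
        ∑ a ∈ (Finset.Icc 1 n).filter (InClasses r L), signedCount a n := by
  rw [excess, numParts_eq_sum, numParts_eq_sum, numParts_eq_sum, add_sub_assoc]
  push_cast
  rw [← Finset.sum_sub_distrib]
  refine congrArg₂ (· + ·) (by simp [oddDistinctsCount])
    (Finset.sum_congr rfl fun a _ => sum_oddEven_sub_sum_evenEven _)

/-- Parts are distinct, so each partition contains `a` at most once, and deleting it leaves exactly
the partitions allowed by condition ii. -/
theorem oddDistinctsCount_eq {a n : ℕ} (ha : Odd a) (han : a ≤ n) :
    oddDistinctsCount a n = condIICount a (n - a) := by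
  classical
  obtain ⟨m, rfl⟩ := Nat.exists_eq_add_of_le' han
  have h1 : oddDistinctsCount a (m + a) = ∑ lam : (m + a).Partition,
      if (∀ x ∈ lam.parts, Odd x) ∧ lam.parts.Nodup then lam.parts.count a else 0 := by
    rw [oddDistinctsCount, ← Finset.sum_filter]
    refine Finset.sum_congr ?_ fun _ _ => rfl
    ext lam
    simp [mem_oddDistincts]
  rw [h1, sum_partition_add
    (fun s => if (∀ x ∈ s, Odd x) ∧ s.Nodup then s.count a else 0) m a ha.pos
    (fun s hs => by simp [Multiset.count_eq_zero.2 hs]), condIICount, Finset.card_filter,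
    Nat.add_sub_cancel]
  refine Finset.sum_congr rfl fun mu _ => ?_
  have : CondII mu a ↔ (∀ x ∈ a ::ₘ mu.parts, Odd x) ∧ (a ::ₘ mu.parts).Nodup := by
    rw [CondII, mem_oddDistincts, Multiset.nodup_cons]
    simp only [ha, Nat.not_even_iff_odd.2 ha, Multiset.mem_cons, forall_eq_or_imp, true_and,
      forall_true_left, false_imp_iff, and_true]
    tauto
  by_cases h : CondII mu a
  · rw [if_pos h, if_pos (this.1 h), Multiset.count_cons_self]
    have hnd := (this.1 h).2
    rw [Multiset.nodup_cons] at hnd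
    rw [Multiset.count_eq_zero.2 hnd.1]
  · rw [if_neg h, if_neg (fun h' => h (this.2 h'))]

/-! ### The excluded two-part partitions -/

/-- As partitions, both excluded pairs have sum `a`; for `a = 2` they would contain a part 0. -/
theorem condIICount_of_ne {a m : ℕ} (ha : 0 < a) (he : Even a) (h : m ≠ a ∨ a = 2) :
    condIICount a m = gapCount a m := by
  classical
  rw [condIICount, gapCount]
  refine congrArg Finset.card (Finset.ext fun lam => ?_)
  obtain ⟨k, rfl⟩ := he
  rw [Finset.mem_filter, Finset.mem_filter, and_iff_right (Finset.mem_univ _), CondII]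
  have h1 : lam.parts ≠ {(k + k) / 2 + 1, (k + k) / 2 - 1} := by
    intro hp
    have hs := lam.parts_sum
    have hpos := lam.parts_pos (i := (k + k) / 2 - 1) (by rw [hp]; simp)
    rw [hp] at hs
    simp at hs
    omega
  have h2 : lam.parts ≠ {(k + k) / 2 + 2, (k + k) / 2 - 2} := by
    intro hp
    have hs := lam.parts_sum
    have hpos := lam.parts_pos (i := (k + k) / 2 - 2) (by rw [hp]; simp)
    rw [hp] at hs
    simp at hs
    omega
  have h3 : ¬ Odd (k + k) := by simp
  exact ⟨fun h => ⟨h.1, (h.2.2 (by simp)).1⟩,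
    fun h => ⟨h.1, fun ho => absurd ho h3, fun _ => ⟨h.2, h1, h2⟩⟩⟩

theorem condIICount_self {a : ℕ} (ha : 2 < a) (he : Even a) :
    condIICount a a + 1 = gapCount a a := by
  classical
  obtain ⟨k, rfl⟩ := he
  have hk : (k + k) / 2 = k := by omega
  -- Only the candidate with odd parts excludes anything: `d = 1` for even `k`, `d = 2` for odd `k`.
  obtain ⟨d, hd, hdk, hodd, huniq⟩ : ∃ d, 0 < d ∧ d < k ∧ (Odd (k - d) ∧ Odd (k + d)) ∧
      ∀ lam : (k + k).Partition, lam ∈ Nat.Partition.oddDistincts (k + k) →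
        ((lam.parts ≠ {k + 1, k - 1} ∧ lam.parts ≠ {k + 2, k - 2}) ↔
          lam.parts ≠ {k + d, k - d}) := by
    rcases Nat.even_or_odd k with hk2 | hk2
    · refine ⟨1, by omega, by omega, by grind, fun lam hlam => and_iff_left ?_⟩
      intro h
      have := (mem_oddDistincts.1 hlam).1 (k + 2) (by simp [h])
      grind
    · refine ⟨2, by omega, by grind, by grind, fun lam hlam => and_iff_right ?_⟩
      intro h
      have := (mem_oddDistincts.1 hlam).1 (k + 1) (by simp [h])
      grind
  let mu : (k + k).Partition := ⟨{k + d, k - d}, fun {i} hi => by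
    simp only [Multiset.insert_eq_cons, Multiset.mem_cons, Multiset.mem_singleton] at hi
    omega, by simp; omega⟩
  have hmu : mu ∈ Nat.Partition.oddDistincts (k + k) := by
    rw [mem_oddDistincts]
    refine ⟨fun x hx => ?_, ?_⟩
    · simp only [mu, Multiset.insert_eq_cons, Multiset.mem_cons, Multiset.mem_singleton] at hx
      rcases hx with rfl | rfl
      exacts [hodd.2, hodd.1]
    · simp only [mu, Multiset.insert_eq_cons, Multiset.nodup_cons, Multiset.mem_singleton,
        Multiset.nodup_singleton, and_true]
      omega
  rw [gapCount_of_le le_rfl, ← Finset.card_erase_add_one hmu, condIICount]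
  refine congrArg (fun s : Finset (k + k).Partition => s.card + 1) (Finset.ext fun lam => ?_)
  have hgap : ∀ lam : (k + k).Partition, lam ∈ Nat.Partition.oddDistincts (k + k) →
      part lam 1 - part lam 2 ≤ k + k :=
    Finset.card_filter_eq_iff.1 (gapCount_of_le (le_refl (k + k)))
  have hne : lam ≠ mu ↔ lam.parts ≠ {k + d, k - d} := by
    rw [ne_eq, Nat.Partition.ext_iff]
  simp only [Finset.mem_filter, Finset.mem_univ, true_and, CondII, hk, Finset.mem_erase, hne]
  constructor
  · rintro ⟨h1, -, h2⟩
    exact ⟨(huniq lam h1).1 (h2 (by simp)).2, h1⟩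
  · rintro ⟨h1, h2⟩
    exact ⟨h2, fun h => absurd h (by simp), fun _ => ⟨hgap lam h2, (huniq lam h2).2 h1⟩⟩

theorem condIICount_eq {a : ℕ} (ha : 0 < a) (he : Even a) (m : ℕ) :
    (condIICount a m : ℤ) =
      (gapCount a m - if m = a then 1 else 0) + if a = 2 ∧ m = 2 then 1 else 0 := by
  by_cases hm : m = a
  · subst hm
    by_cases h2 : m = 2
    · rw [condIICount_of_ne ha he (Or.inr h2)]
      simp [h2]
    · have : 2 < m := by
        obtain ⟨k, rfl⟩ := he
        omega
      have := condIICount_self this he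
      simp only [h2, and_self, if_true, if_false]
      omega
  · rw [condIICount_of_ne ha he (Or.inl hm), if_neg hm, if_neg (by omega)]
    ring

theorem sum_condIICount_of_odd {a n : ℕ} (ha : Odd a) (han : a ≤ n) :
    ∑ b ∈ (Finset.range (n + 1)).filter (fun b => Odd b ∧ a * b ≤ n ∧ (Odd a → b = 1)),
      condIICount a (n - a * b) = oddDistinctsCount a n := by
  have : (Finset.range (n + 1)).filter (fun b => Odd b ∧ a * b ≤ n ∧ (Odd a → b = 1)) = {1} := by
    ext b
    simp only [Finset.mem_filter, Finset.mem_range, Finset.mem_singleton]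
    constructor
    · exact fun h => h.2.2.2 ha
    · rintro rfl
      have := ha.pos
      exact ⟨by omega, odd_one, by omega, fun _ => rfl⟩
  rw [this, Finset.sum_singleton, mul_one, oddDistinctsCount_eq ha han]

theorem sum_condIICount_of_even {a n : ℕ} (hn : 0 < n) (ha : 0 < a) (he : Even a) :
    ((∑ b ∈ (Finset.range (n + 1)).filter (fun b => Odd b ∧ a * b ≤ n ∧ (Odd a → b = 1)),
      condIICount a (n - a * b) : ℕ) : ℤ) =
        signedCount a n + if a = 2 ∧ 4 ∣ n then 1 else 0 := by
  have ho : ¬ Odd a := Nat.not_odd_iff_even.2 he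
  simp only [ho, false_imp_iff, and_true]
  rw [signedCount_eq ha he, oddMultipleSum, Nat.cast_sum]
  simp only [condIICount_eq ha he]
  rw [Finset.sum_add_distrib, add_right_inj]
  by_cases h : a = 2 ∧ 4 ∣ n
  · obtain ⟨rfl, k, rfl⟩ := h
    -- The surplus occurs once, at the solution `b = 2k - 1` of `4k - 2b = 2`, which is odd.
    rw [if_pos (by simp), Finset.sum_eq_single_of_mem (2 * k - 1)]
    · rw [if_pos (by omega)]
    · simp only [Finset.mem_filter, Finset.mem_range]
      exact ⟨by omega, ⟨k - 1, by omega⟩, by omega⟩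
    · intro b hb hne
      simp only [Finset.mem_filter, Finset.mem_range] at hb
      rw [if_neg (by omega)]
  · rw [if_neg h]
    refine Finset.sum_eq_zero fun b hb => ?_
    simp only [Finset.mem_filter, Finset.mem_range] at hb
    obtain ⟨-, ⟨k, rfl⟩, hb⟩ := hb
    rw [if_neg]
    rintro ⟨rfl, h2⟩
    exact h ⟨rfl, k + 1, by omega⟩


/-! ### Residue classes, the exceptional pair and the conclusion -/

theorem InClasses.even_iff {r : ℕ} {S : Finset ℕ} {x : ℕ} (h : InClasses r S x) :
    ∃ l ∈ S, (Even x ↔ Even l) := by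
  obtain ⟨l, hl, hx⟩ := h
  refine ⟨l, hl, ?_⟩
  have : x % 2 = l % 2 := hx.of_mul_right r
  rw [Nat.even_iff, Nat.even_iff, this]

theorem inClasses_union {r : ℕ} {S T : Finset ℕ} {x : ℕ} :
    InClasses r (S ∪ T) x ↔ InClasses r S x ∨ InClasses r T x := by
  simp only [InClasses, Finset.mem_union, or_and_right, exists_or]

theorem card_admissiblePairs_eq {n r : ℕ} {L O : Finset ℕ} (hn : 0 < n)
    (hL : ∀ l ∈ L, Even l) (hO : ∀ l ∈ O, Odd l) :
    ((admissiblePairs n r L O).card : ℤ) =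
      excess n r L O + if InClasses r L 2 ∧ 4 ∣ n then 1 else 0 := by
  have hodd {a : ℕ} (h : InClasses r O a) : Odd a := by
    obtain ⟨l, hl, hal⟩ := h.even_iff
    rw [← Nat.not_even_iff_odd, hal, Nat.not_even_iff_odd]
    exact hO l hl
  have heven {a : ℕ} (h : InClasses r L a) : Even a := by
    obtain ⟨l, hl, hal⟩ := h.even_iff
    exact hal.2 (hL l hl)
  have hdisj : Disjoint ((Finset.Icc 1 n).filter (InClasses r L))
      ((Finset.Icc 1 n).filter (InClasses r O)) := by
    rw [Finset.disjoint_filter]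
    exact fun a _ h1 h2 => Nat.not_even_iff_odd.2 (hodd h2) (heven h1)
  have hunion : (Finset.Icc 1 n).filter (InClasses r (L ∪ O)) =
      (Finset.Icc 1 n).filter (InClasses r L) ∪ (Finset.Icc 1 n).filter (InClasses r O) := by
    rw [← Finset.filter_or]
    exact Finset.filter_congr fun a _ => inClasses_union
  rw [card_admissiblePairs, hunion, Finset.sum_union hdisj, excess_eq_sum, Nat.cast_add,
    Nat.cast_sum, Nat.cast_sum]
  have h1 : ∀ a ∈ (Finset.Icc 1 n).filter (InClasses r O),
      ((∑ b ∈ (Finset.range (n + 1)).filter (fun b => Odd b ∧ a * b ≤ n ∧ (Odd a → b = 1)),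
        condIICount a (n - a * b) : ℕ) : ℤ) = oddDistinctsCount a n := by
    intro a ha
    simp only [Finset.mem_filter, Finset.mem_Icc] at ha
    rw [sum_condIICount_of_odd (hodd ha.2) ha.1.2]
  have h2 : ∀ a ∈ (Finset.Icc 1 n).filter (InClasses r L),
      ((∑ b ∈ (Finset.range (n + 1)).filter (fun b => Odd b ∧ a * b ≤ n ∧ (Odd a → b = 1)),
        condIICount a (n - a * b) : ℕ) : ℤ) =
          signedCount a n + if a = 2 ∧ 4 ∣ n then 1 else 0 := by
    intro a ha
    simp only [Finset.mem_filter, Finset.mem_Icc] at ha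
    exact sum_condIICount_of_even hn ha.1.1 (heven ha.2)
  rw [Finset.sum_congr rfl h1, Finset.sum_congr rfl h2, Finset.sum_add_distrib]
  have h3 : ∑ a ∈ (Finset.Icc 1 n).filter (InClasses r L),
      (if a = 2 ∧ 4 ∣ n then 1 else 0 : ℤ) = if InClasses r L 2 ∧ 4 ∣ n then 1 else 0 := by
    by_cases h4 : 4 ∣ n
    · have : 2 ≤ n := by have := Nat.le_of_dvd hn h4; omega
      simp only [h4, and_true, Finset.sum_ite_eq', Finset.mem_filter, Finset.mem_Icc, this]
      simp
    · simp [h4]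
  rw [h3]
  ring

/-- The representatives lie in `[2, 2r]`, so `l - 2 < 2r` and divisibility by `2r` forces `l = 2`.
-/
theorem inClasses_two_iff {r : ℕ} {L : Finset ℕ} (hL : ∀ l ∈ L, Even l ∧ 2 ≤ l ∧ l ≤ 2 * r) :
    InClasses r L 2 ↔ 2 ∈ L := by
  constructor
  · rintro ⟨l, hl, h⟩
    obtain ⟨-, h2, hr⟩ := hL l hl
    have hd : 2 * r ∣ l - 2 := (Nat.modEq_iff_dvd' h2).1 h
    have : l - 2 = 0 := Nat.eq_zero_of_dvd_of_lt hd (by omega)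
    rwa [show l = 2 by omega] at hl
  · exact fun h => ⟨2, h, rfl⟩

/-- Since 9 + 7 + 5 + 1 = 22, the size forces `b = (n - 22) / 2`, which is positive for `n ≥ 24` and
odd because `4 ∣ n`. The gap 9 - 7 = 2 is just allowed, so exactly one admissible pair is
exceptional. -/
theorem card_exceptional {n r : ℕ} {L O : Finset ℕ} (h4 : 4 ∣ n) (hn : 24 ≤ n) (h2 : 2 ∈ L) :
    (nonExceptionalPairs n r L O).card + 1 = (admissiblePairs n r L O).card := by
  classical
  have hpos : ∀ i ∈ ({9, 7, 5, 1} : Multiset ℕ), 0 < i := by decide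
  let lam : (Nat.Partition 22) := ⟨{9, 7, 5, 1}, fun {i} hi => hpos i hi, by decide⟩
  let q : PartitionPair := ⟨(22, 2 * ((n - 22) / 2)), lam, rectangle 2 ((n - 22) / 2) two_pos⟩
  have hsort : part lam 1 - part lam 2 ≤ 2 := by
    rw [gap_le_iff (M := 9) (u := {7, 5, 1}) rfl (by decide)]
    decide
  have hq : q ∈ admissiblePairs n r L O := by
    simp only [admissiblePairs, pairs, Finset.mem_filter, Finset.mem_sigma,
      Finset.HasAntidiagonal.mem_antidiagonal, Finset.mem_univ, and_true]
    refine ⟨by dsimp only [q]; omega, 2, (n - 22) / 2, two_pos, by omega, rfl,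
      ⟨⟨2, by simp [h2], rfl⟩, ?_, fun h => absurd h (by decide)⟩, ?_, fun h => absurd h (by decide),
        fun _ => ⟨hsort, by dsimp only [PartitionPair.first, q, lam]; decide,
          by dsimp only [PartitionPair.first, q, lam]; decide⟩⟩
    · obtain ⟨k, rfl⟩ := h4
      exact ⟨k - 6, by omega⟩
    · rw [mem_oddDistincts]
      dsimp only [PartitionPair.first, q, lam]
      decide
  have : nonExceptionalPairs n r L O = (admissiblePairs n r L O).erase q := by
    ext p
    rw [nonExceptionalPairs, Finset.mem_filter, Finset.mem_erase, and_comm]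
    refine and_congr_left fun hp => not_congr ⟨?_, ?_⟩
    · rintro ⟨h1, b, hb⟩
      refine PartitionPair.ext_parts h1 (hb.trans ?_)
      simp only [admissiblePairs, pairs, Finset.mem_filter, Finset.mem_sigma,
        Finset.HasAntidiagonal.mem_antidiagonal, Finset.mem_univ, and_true] at hp
      have hs1 := p.first.parts_sum
      have hs2 := p.second.parts_sum
      rw [h1] at hs1
      rw [hb] at hs2
      simp only [Multiset.insert_eq_cons, Multiset.sum_cons, Multiset.sum_singleton,
        Multiset.sum_replicate, smul_eq_mul] at hs1 hs2
      have : b = (n - 22) / 2 := by omega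
      rw [this]
      rfl
    · rintro rfl
      exact ⟨rfl, _, rfl⟩
  rw [this, Finset.card_erase_add_one hq]

end BeckLehmer

theorem mainTheorem9 (n r : ℕ) (hn : 0 < n) (hr : 0 < r) (L O : Finset ℕ)
    (hL : ∀ l ∈ L, Even l ∧ 2 ≤ l ∧ l ≤ 2 * r)
    (hO : ∀ l ∈ O, Odd l ∧ 1 ≤ l ∧ l ≤ 2 * r - 1) :
    ((4 ∣ n → 2 ∉ L) →
      BeckLehmer.excess n r L O = ((BeckLehmer.admissiblePairs n r L O).card : ℤ)) ∧
    (4 ∣ n → 2 ∈ L →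
      BeckLehmer.excess n r L O = ((BeckLehmer.admissiblePairs n r L O).card : ℤ) - 1 ∧
      (n ∉ ({4, 8, 12, 16, 20} : Finset ℕ) →
        BeckLehmer.excess n r L O =
          ((BeckLehmer.nonExceptionalPairs n r L O).card : ℤ))) := by
  have h := BeckLehmer.card_admissiblePairs_eq (r := r) hn (fun l hl => (hL l hl).1)
    (fun l hl => (hO l hl).1)
  simp only [BeckLehmer.inClasses_two_iff hL] at h
  refine ⟨fun h1 => ?_, fun h4 h2 => ?_⟩
  · rw [if_neg (fun h' => h1 h'.2 h'.1), add_zero] at h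
    exact h.symm
  · rw [if_pos ⟨h2, h4⟩] at h
    refine ⟨by omega, fun hne => ?_⟩
    have := BeckLehmer.card_exceptional (r := r) (O := O) h4 (n := n)
      (by simp only [Finset.mem_insert, Finset.mem_singleton, not_or] at hne; omega) h2
    omega
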